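/- Let $k$ be a field, $n\ge 0$ and $S=k[x_1,\dots,x_n]$ with the standard grading. For a monomial ideal $I\subset S$ let $G(I)$ be its minimal system of monomial generators. The \emph{critical} squarefree monomial ideals of $S$ are those obtained recursively as follows: (a) every ideal $(x_i,m)$, with $x_i$ a variable and $m$ a squarefree monomial such that $x_i\nmid m$, is critical; (b) if $J$ is critical, $x_j$ is a variable and $m'$ is a squarefree monomial such that $x_j\nmid mm'$ and $\operatorname{supp}(m)\cap\operatorname{supp}(m')=\emptyset$ for all $m\in G(J)$, then $(x_j)+m'J$ is critical. A squarefree monomial ideal $I$ is \emph{canonical critical} if $I=wJ$ for some monomial $w$ and some critical squarefree monomial ideal $J$. Then: (1) Every critical squarefree monomial ideal $I$ has linear quotients, that is, $G(I)$ can be ordered as $u_1,\dots,u_s$ such that for each $t$ the colon ideal $(u_1,\dots,u_{t-1}):u_t$ is generated by a (possibly empty) set of variables. (2) Every canonical critical squarefree monomial ideal $I$ is componentwise linear, that is, $I$ is graded and for every $j\ge 0$ the ideal $I_{\langle j\rangle}$ generated by all homogeneous polynomials of degree $j$ in $I$ has a linear resolution, i.e. a graded free resolution $\cdots\to S(-j-2)^{b_2}\to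 S(-j-1)^{b_1}\to S(-j)^{b_0}\to I_{\langle j\rangle}\to 0$ with all $b_i$ finite (the zero ideal counts as having a linear resolution). -/

import Mathlib

namespace CriticalIdeal

open MvPolynomial

attribute [local instance] MvPolynomial.gradedAlgebra

/-- The polynomial ring `S = k[x_1, …, x_n]`. A monomial of `S` is represented by its exponent
vector `a : Fin n →₀ ℕ`; divisibility of monomials is the order `≤` on exponent vectors. -/
abbrev S (k : Type*) [Field k] (n : ℕ) := MvPolynomial (Fin n) k

/-- The monomial with exponent vector `a`, as an element of `S`. -/
noncomputable abbrev mon (k : Type*) [Field k] {n : ℕ} (a : Fin n →₀ ℕ) : S k n :=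
  monomial a 1

/-- The monomial with exponent vector `a` is squarefree. -/
def IsSquarefreeMon {n : ℕ} (a : Fin n →₀ ℕ) : Prop := ∀ i, a i ≤ 1

variable {k : Type*} [Field k] {n : ℕ}

/-- `I` is generated by monomials. -/
def IsMonomialIdeal (I : Ideal (S k n)) : Prop :=
  ∃ A : Set (Fin n →₀ ℕ), I = Ideal.span (mon k '' A)

/-- `I` is generated by squarefree monomials. -/
def IsSquarefreeMonomialIdeal (I : Ideal (S k n)) : Prop :=
  ∃ A : Set (Fin n →₀ ℕ), (∀ a ∈ A, IsSquarefreeMon a) ∧ I = Ideal.span (mon k '' A)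

/-- `G(I)`: the monomials of `I` that are minimal with respect to divisibility. For a monomial
ideal this is its unique minimal system of monomial generators. -/
def minGens (I : Ideal (S k n)) : Set (Fin n →₀ ℕ) :=
  {a | Minimal (fun b => mon k b ∈ I) a}

/-- Critical squarefree monomial ideals: `(x_i, m)` with `m` a squarefree monomial, `x_i ∤ m`;
and `(x_j) + m' J` with `J` critical, `m'` a squarefree monomial, `x_j ∤ m m'` and
`supp m ∩ supp m' = ∅` for all `m ∈ G(J)`. -/
inductive IsCritical : Ideal (S k n) → Prop
  | base (i : Fin n) (m : Fin n →₀ ℕ) (hm : IsSquarefreeMon m) (him : m i = 0) :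
      IsCritical (Ideal.span {X i, mon k m})
  | step (j : Fin n) (m' : Fin n →₀ ℕ) (J : Ideal (S k n)) (hJ : IsCritical J)
      (hm' : IsSquarefreeMon m')
      (hj : ∀ m ∈ minGens J, (m + m') j = 0)
      (hdisj : ∀ m ∈ minGens J, Disjoint m.support m'.support) :
      IsCritical (Ideal.span {X j} + Ideal.span {mon k m'} * J)

/-- Canonical critical squarefree monomial ideals: squarefree monomial ideals of the form `w J`
with `w` a monomial and `J` critical. -/
def IsCanonicalCritical (I : Ideal (S k n)) : Prop :=
  IsSquarefreeMonomialIdeal I ∧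
    ∃ (w : Fin n →₀ ℕ) (J : Ideal (S k n)), IsCritical J ∧ I = Ideal.span {mon k w} * J

/-- The monomial ideal `I` has linear quotients: `G(I)` can be ordered as `u_1, …, u_s` such that
each colon ideal `(u_1, …, u_{t-1}) : u_t` is generated by a set of variables. -/
def HasLinearQuotients (I : Ideal (S k n)) : Prop :=
  IsMonomialIdeal I ∧
    ∃ (s : ℕ) (u : Fin s → (Fin n →₀ ℕ)),
      Function.Injective u ∧ Set.range u = minGens I ∧
      ∀ t : Fin s, ∃ V : Set (Fin n),
        (Ideal.span ((fun r => mon k (u r)) '' Set.Iio t)).colon {mon k (u t)} =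
          Ideal.span (X '' V)

/-- A `d`-linear resolution of the ideal `I`: a graded free resolution
`⋯ → S(-d-2)^{ι 2} → S(-d-1)^{ι 1} → S(-d)^{ι 0} → I → 0` with finite index sets `ι i`, given by
matrices. The entries of the augmentation are forms of degree `d`, those of the differentials
are linear forms; in particular such a resolution is minimal. -/
structure LinearResolution (d : ℕ) (I : Ideal (S k n)) where
  /-- The basis of the `i`-th free module, whose elements have degree `d + i`. -/
  ι : ℕ → Type
  /-- The free modules have finite rank. -/
  fintype : ∀ i, Fintype (ι i)
  /-- The augmentation, by the images of the basis elements. -/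
  ε : ι 0 → S k n
  /-- The differentials. -/
  φ : ∀ i, Matrix (ι i) (ι (i + 1)) (S k n)
  ε_homogeneous : ∀ c, (ε c).IsHomogeneous d
  φ_homogeneous : ∀ i r c, (φ i r c).IsHomogeneous 1
  range_ε : LinearMap.range (Fintype.linearCombination (S k n) ε) = I
  exact_zero :
    Function.Exact (φ 0).mulVecLin (Fintype.linearCombination (S k n) ε)
  exact_succ : ∀ i, Function.Exact (φ (i + 1)).mulVecLin (φ i).mulVecLin

/-- `I` has a `d`-linear resolution. -/
def HasLinearResolution (d : ℕ) (I : Ideal (S k n)) : Prop :=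
  Nonempty (LinearResolution d I)

/-- `I_{⟨j⟩}`: the ideal generated by all homogeneous polynomials of degree `j` in `I`. -/
noncomputable def component (I : Ideal (S k n)) (j : ℕ) : Ideal (S k n) :=
  Ideal.span {f | f ∈ I ∧ f.IsHomogeneous j}

/-- The ideal `I` is graded, and each `I_{⟨j⟩}` has a linear resolution. Since `I_{⟨j⟩}` is
generated in degree `j`, this resolution is `j`-linear. -/
def IsComponentwiseLinear (I : Ideal (S k n)) : Prop :=
  I.IsHomogeneous (homogeneousSubmodule (Fin n) k) ∧
    ∀ j, HasLinearResolution j (component I j)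

end CriticalIdeal

namespace CriticalIdeal

open MvPolynomial

attribute [local instance] MvPolynomial.gradedAlgebra

variable {k : Type*} [Field k] {n : ℕ}

attribute [instance] LinearResolution.fintype

/-! Both claims rest on one invariant, `IsLinearFamily`: the generators are ordered so that degrees
do not decrease and colons with earlier generators are generated by variables. Multiplying by a
monomial preserves it. So does putting a new variable `x_j` first: `x_j` divides no later generator,
so its colon by each of them is `x_j` itself. Since `(x_i, m) = (x_i) + m S`, every critical ideal
arises from the unit ideal by these two moves, and (1) follows by reading off the colons.

For (2), the degree-`d` monomials of such an ideal are ordered by the first generator dividing them,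
ties being broken by lex. This order again has linear quotients
(`IsLinearFamily.hasLinearResolution`). Linear quotients in a single degree give a linear
resolution: adding one generator `u` to `I` is a mapping cone over a linear resolution of `I : u`,
an ideal of variables (`LinearResolution.nonempty_cone`). -/

/-! ### Homogeneous lifting -/

theorem homogeneousComponent_mul_of_isHomogeneous {p : S k n} {m : ℕ} (hp : p.IsHomogeneous m)
    (q : S k n) (e : ℕ) :
    homogeneousComponent (e + m) (p * q) = p * homogeneousComponent e q := by
  have hi : ∀ i, homogeneousComponent (e + m) (p * homogeneousComponent i q) =
      if i = e then p * homogeneousComponent e q else 0 := by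
    intro i
    rw [homogeneousComponent_of_mem (hp.mul (homogeneousComponent_isHomogeneous i q))]
    by_cases h : i = e
    · subst h
      simp [add_comm]
    · rw [if_neg (by omega), if_neg h]
  conv_lhs => rw [← sum_homogeneousComponent q]
  rw [Finset.mul_sum, map_sum, Finset.sum_congr rfl fun i _ => hi i, Finset.sum_ite_eq']
  split_ifs with h
  · rfl
  · rw [homogeneousComponent_eq_zero e q (by simpa using h), mul_zero]

/-- Homogeneous elements in the range of a homogeneous matrix have homogeneous preimages. -/
theorem exists_isHomogeneous_mulVec_eq {α β : Type*} [Fintype β] {A : Matrix α β (S k n)}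
    {m e : ℕ} (hA : ∀ a b, (A a b).IsHomogeneous m) {v : α → S k n}
    (hv : ∀ a, (v a).IsHomogeneous (e + m)) {w : β → S k n} (hw : A.mulVec w = v) :
    ∃ w' : β → S k n, (∀ b, (w' b).IsHomogeneous e) ∧ A.mulVec w' = v := by
  refine ⟨fun b => homogeneousComponent e (w b),
    fun b => homogeneousComponent_isHomogeneous e (w b), ?_⟩
  funext a
  rw [← homogeneousComponent_eq_self (hv a), ← hw]
  simp only [Matrix.mulVec, dotProduct, map_sum]
  exact Finset.sum_congr rfl fun b _ =>
    (homogeneousComponent_mul_of_isHomogeneous (hA a b) (w b) e).symm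

theorem exists_isHomogeneous_mul_eq {α β γ : Type*} [Fintype β] {A : Matrix α β (S k n)}
    {m e : ℕ} (hA : ∀ a b, (A a b).IsHomogeneous m) {B : Matrix α γ (S k n)}
    (hB : ∀ a c, (B a c).IsHomogeneous (e + m))
    (h : ∀ c, ∃ w : β → S k n, A.mulVec w = fun a => B a c) :
    ∃ W : Matrix β γ (S k n), (∀ b c, (W b c).IsHomogeneous e) ∧ A * W = B := by
  choose w hw using fun c => exists_isHomogeneous_mulVec_eq hA (fun a => hB a c) (h c).choose_spec
  refine ⟨fun b c => w c b, fun b c => (hw c).1 b, ?_⟩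
  ext1 a c
  exact congrFun (hw c).2 a

/-! ### Mapping cones of linear resolutions -/

namespace LinearResolution

variable {d e : ℕ} {I P : Ideal (S k n)}

theorem φ_mul_φ (R : LinearResolution d I) (i : ℕ) : R.φ i * R.φ (i + 1) = 0 := by
  classical
  apply Matrix.toLin'.injective
  rw [Matrix.toLin'_mul, map_zero]
  exact (R.exact_succ i).linearMap_comp_eq_zero

theorem ε_vecMul_φ (R : LinearResolution d I) : Matrix.vecMul R.ε (R.φ 0) = 0 := by
  classical
  funext c
  have := R.exact_zero.apply_apply_eq_zero (Pi.single c 1)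
  simpa [Fintype.linearCombination_apply, Matrix.vecMul, dotProduct, mul_comm] using this

/-- `ψ` is a homogeneous comparison map that extends to the next degree. -/
def Extends (R : LinearResolution d I) (K : LinearResolution e P) (i : ℕ)
    (ψ : Matrix (R.ι i) (K.ι i) (S k n)) : Prop :=
  (∀ a c, (ψ a c).IsHomogeneous 1) ∧
    ∀ c, ∃ w : R.ι (i + 1) → S k n, (R.φ i).mulVec w = fun a => (-(ψ * K.φ i)) a c

theorem isHomogeneous_neg_mul {α β γ : Type*} [Fintype β] {A : Matrix α β (S k n)}
    {B : Matrix β γ (S k n)} {l m : ℕ} (hA : ∀ a b, (A a b).IsHomogeneous l)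
    (hB : ∀ b c, (B b c).IsHomogeneous m) (a : α) (c : γ) :
    ((-(A * B)) a c).IsHomogeneous (l + m) := by
  rw [Matrix.neg_apply, Matrix.mul_apply]
  exact (IsHomogeneous.sum _ _ _ fun b _ => (hA a b).mul (hB b c)).neg

theorem Extends.exists_succ {R : LinearResolution d I} {K : LinearResolution e P} {i : ℕ}
    {ψ : Matrix (R.ι i) (K.ι i) (S k n)} (h : Extends R K i ψ) :
    ∃ ψ' : Matrix (R.ι (i + 1)) (K.ι (i + 1)) (S k n),
      Extends R K (i + 1) ψ' ∧ R.φ i * ψ' = -(ψ * K.φ i) := by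
  obtain ⟨ψ', h1, h2⟩ := exists_isHomogeneous_mul_eq (R.φ_homogeneous i)
    (isHomogeneous_neg_mul h.1 (K.φ_homogeneous i)) h.2
  refine ⟨ψ', ⟨h1, fun c => ?_⟩, h2⟩
  -- The next obstruction is a cycle because two consecutive differentials of `K` compose to zero.
  have hz : R.φ i * -(ψ' * K.φ (i + 1)) = 0 := by
    rw [Matrix.mul_neg, ← Matrix.mul_assoc, h2, Matrix.neg_mul, Matrix.mul_assoc, K.φ_mul_φ,
      Matrix.mul_zero, neg_zero, neg_zero]
  exact (R.exact_succ i _).1 (funext fun a => congrFun (congrFun hz a) c)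

/-- Multiplication by `u` maps the colon ideal into `I`, so it lifts through the augmentation; `K.ε
c * u` has degree `1 + d`, so the lift has linear entries. The sign makes the block triangular maps
of the cone compose to zero. -/
theorem exists_extends_zero (R : LinearResolution d I) {u : S k n} (hu : u.IsHomogeneous d)
    (K : LinearResolution 1 (I.colon {u})) :
    ∃ ψ : Matrix (R.ι 0) (K.ι 0) (S k n),
      Extends R K 0 ψ ∧ ∀ c, Matrix.vecMul R.ε ψ c = -(K.ε c * u) := by
  classical
  have hB : ∀ (a : Unit) c, (Matrix.of (fun (_ : Unit) c => -(K.ε c * u)) a c).IsHomogeneous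
      (1 + d) := fun a c => ((K.ε_homogeneous c).mul hu).neg
  have hw : ∀ c, ∃ w : R.ι 0 → S k n, (Matrix.of (fun (_ : Unit) => R.ε)).mulVec w =
      fun a => Matrix.of (fun (_ : Unit) c => -(K.ε c * u)) a c := by
    intro c
    have hc : K.ε c ∈ I.colon {u} := by
      have : K.ε c ∈ LinearMap.range (Fintype.linearCombination (S k n) K.ε) :=
        ⟨Pi.single c 1, by simp⟩
      rwa [K.range_ε] at this
    have hI : -(K.ε c * u) ∈ I := I.neg_mem (by simpa using Submodule.mem_colon_singleton.1 hc)
    obtain ⟨w, hw⟩ := (SetLike.ext_iff.1 R.range_ε _).2 hI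
    refine ⟨w, funext fun a => ?_⟩
    simpa [Matrix.mulVec, dotProduct, Fintype.linearCombination_apply, mul_comm] using hw
  obtain ⟨ψ, h1, h2⟩ := exists_isHomogeneous_mul_eq (fun _ => R.ε_homogeneous) hB hw
  have h3 : ∀ c, Matrix.vecMul R.ε ψ c = -(K.ε c * u) := fun c => congrFun (congrFun h2 ()) c
  refine ⟨ψ, ⟨h1, fun c => (R.exact_zero _).1 ?_⟩, h3⟩
  have h4 : Matrix.vecMul R.ε (ψ * K.φ 0) = 0 := by
    rw [← Matrix.vecMul_vecMul]
    have : Matrix.vecMul R.ε ψ = (-u) • K.ε := by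
      funext c
      simp [h3, mul_comm]
    rw [this, Matrix.smul_vecMul, K.ε_vecMul_φ, smul_zero]
  have h5 := congrFun h4 c
  simp only [Matrix.vecMul, dotProduct, Pi.zero_apply] at h5
  simp only [Fintype.linearCombination_apply, Matrix.neg_apply, smul_eq_mul, neg_mul,
    Finset.sum_neg_distrib, neg_eq_zero]
  rw [← h5]
  exact Finset.sum_congr rfl fun _ _ => mul_comm _ _

theorem exists_comparison (R : LinearResolution d I) {u : S k n} (hu : u.IsHomogeneous d)
    (K : LinearResolution 1 (I.colon {u})) :
    ∃ ψ : ∀ i, Matrix (R.ι i) (K.ι i) (S k n),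
      (∀ i a c, (ψ i a c).IsHomogeneous 1) ∧
      (∀ c, Matrix.vecMul R.ε (ψ 0) c = -(K.ε c * u)) ∧
      ∀ i, R.φ i * ψ (i + 1) = -(ψ i * K.φ i) := by
  obtain ⟨ψ₀, h₀, h₁⟩ := exists_extends_zero R hu K
  choose f hf hf' using fun i (ψ : {ψ // Extends R K i ψ}) => ψ.2.exists_succ
  let g : ∀ i, {ψ // Extends R K i ψ} := fun i =>
    Nat.rec ⟨ψ₀, h₀⟩ (fun i ψ => ⟨f i ψ, hf i ψ⟩) i
  exact ⟨fun i => (g i).1, fun i => (g i).2.1, h₁, fun i => hf' i (g i)⟩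

/-- Exactness of an upper block triangular matrix with exact diagonal blocks. -/
theorem exact_fromBlocks {β β' γ γ' M N : Type*} [Fintype β] [Fintype β'] [Fintype γ] [Fintype γ']
    [AddCommGroup M] [Module (S k n) M] [Zero N]
    {A : Matrix β γ (S k n)} {C : Matrix β' γ' (S k n)} {ψ : Matrix β γ' (S k n)}
    {f : (β → S k n) →ₗ[S k n] M} {g : (β' → S k n) →ₗ[S k n] M} {T : (β ⊕ β' → S k n) → N}
    (hA : Function.Exact A.mulVecLin f) (hψ : ∀ z, f (ψ.mulVec z) = -g (C.mulVec z))
    (hT : ∀ v, T v = 0 ↔ f (v ∘ Sum.inl) + g (v ∘ Sum.inr) = 0 ∧ ∃ z, C.mulVec z = v ∘ Sum.inr) :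
    Function.Exact (Matrix.fromBlocks A ψ 0 C).mulVecLin T := by
  intro v
  rw [hT]
  constructor
  · rintro ⟨h, z, hz⟩
    -- Once the lower block is hit by `z`, the correction `ψ z` moves the upper block into the
    -- kernel of `f`.
    obtain ⟨y, hy⟩ := (hA (v ∘ Sum.inl - ψ.mulVec z)).1 (by
      rw [map_sub, hψ, hz, sub_neg_eq_add, h])
    refine ⟨Sum.elim y z, ?_⟩
    rw [Matrix.mulVecLin_apply] at hy ⊢
    rw [Matrix.fromBlocks_mulVec, Sum.elim_comp_inl, Sum.elim_comp_inr, hy, hz, Matrix.zero_mulVec,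
      zero_add, sub_add_cancel, Sum.elim_comp_inl_inr]
  · rintro ⟨y, rfl⟩
    rw [Matrix.mulVecLin_apply, Matrix.fromBlocks_mulVec, Sum.elim_comp_inl, Sum.elim_comp_inr,
      Matrix.zero_mulVec, zero_add, map_add, hψ, neg_add_cancel_right]
    exact ⟨hA.apply_apply_eq_zero _, _, rfl⟩

theorem exact_fromBlocks_fromBlocks {α α' β β' γ γ' : Type*} [Fintype β] [Fintype β']
    [Fintype γ] [Fintype γ'] {A₁ : Matrix α β (S k n)} {A₂ : Matrix β γ (S k n)}
    {C₁ : Matrix α' β' (S k n)} {C₂ : Matrix β' γ' (S k n)}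
    {ψ₁ : Matrix α β' (S k n)} {ψ₂ : Matrix β γ' (S k n)}
    (hA : Function.Exact A₂.mulVecLin A₁.mulVecLin) (hC : Function.Exact C₂.mulVecLin C₁.mulVecLin)
    (hψ : A₁ * ψ₂ = -(ψ₁ * C₂)) :
    Function.Exact (Matrix.fromBlocks A₂ ψ₂ 0 C₂).mulVecLin
      (Matrix.fromBlocks A₁ ψ₁ 0 C₁).mulVecLin := by
  refine exact_fromBlocks (f := A₁.mulVecLin) (g := ψ₁.mulVecLin) hA (fun z => ?_) fun v => ?_
  · simp only [Matrix.mulVecLin_apply, Matrix.mulVec_mulVec, hψ, Matrix.neg_mulVec]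
  · rw [Matrix.mulVecLin_apply, Matrix.fromBlocks_mulVec, Matrix.zero_mulVec, zero_add]
    have h := hC (v ∘ Sum.inr)
    simp only [Set.mem_range, Matrix.mulVecLin_apply] at h
    rw [← h, Matrix.mulVecLin_apply, Matrix.mulVecLin_apply]
    constructor
    · intro h
      exact ⟨funext fun a => congrFun h (Sum.inl a), funext fun a => congrFun h (Sum.inr a)⟩
    · rintro ⟨h, h'⟩
      rw [h, h']
      funext a
      rcases a with a | a <;> rfl

/-- The index types of the mapping cone. -/
def coneIndex (α β : ℕ → Type) : ℕ → Type
  | 0 => α 0 ⊕ Unit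
  | i + 1 => α (i + 1) ⊕ β i

/-- The mapping cone of a comparison map from a linear resolution of a colon ideal. -/
theorem nonempty_cone (R : LinearResolution d I) {u : S k n} (hu : u.IsHomogeneous d)
    (K : LinearResolution 1 (I.colon {u})) : Nonempty (LinearResolution d (I ⊔ Ideal.span {u})) := by
  obtain ⟨ψ, hψ, h₀, hs⟩ := exists_comparison R hu K
  refine ⟨{
    ι := coneIndex R.ι K.ι
    fintype := fun
      | 0 => inferInstanceAs (Fintype (R.ι 0 ⊕ Unit))
      | i + 1 => inferInstanceAs (Fintype (R.ι (i + 1) ⊕ K.ι i))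
    ε := Sum.elim R.ε fun _ => u
    φ := fun
      | 0 => Matrix.fromBlocks (R.φ 0) (ψ 0) 0 (Matrix.of fun _ => K.ε)
      | i + 1 => Matrix.fromBlocks (R.φ (i + 1)) (ψ (i + 1)) 0 (K.φ i)
    ε_homogeneous := by
      rintro (c | c)
      · exact R.ε_homogeneous c
      · exact hu
    φ_homogeneous := by
      rintro (_ | i) (r | r) (c | c)
      · exact R.φ_homogeneous 0 r c
      · exact hψ 0 r c
      · exact isHomogeneous_zero _ _ _
      · exact K.ε_homogeneous c
      · exact R.φ_homogeneous (i + 1) r c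
      · exact hψ (i + 1) r c
      · exact isHomogeneous_zero _ _ _
      · exact K.φ_homogeneous i r c
    range_ε := ?_
    exact_zero := ?_
    exact_succ := ?_ }⟩
  · have hR : ∀ x, Fintype.linearCombination (S k n) R.ε x ∈ I := fun x =>
      (SetLike.ext_iff.1 R.range_ε _).1 ⟨x, rfl⟩
    have hadd : ∀ v : R.ι 0 ⊕ Unit → S k n,
        Fintype.linearCombination (S k n) (Sum.elim R.ε fun _ => u) v =
          Fintype.linearCombination (S k n) R.ε (v ∘ Sum.inl) + v (Sum.inr ()) * u := by
      intro v
      simp [Fintype.linearCombination_apply]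
    ext f
    rw [Submodule.mem_sup]
    constructor
    · rintro ⟨v, rfl⟩
      exact ⟨_, hR (v ∘ Sum.inl), _,
        Ideal.mul_mem_left _ (v (Sum.inr ())) (Ideal.mem_span_singleton_self u), (hadd v).symm⟩
    · rintro ⟨y, hy, z, hz, rfl⟩
      obtain ⟨x, rfl⟩ := (SetLike.ext_iff.1 R.range_ε _).2 hy
      obtain ⟨c, rfl⟩ := Ideal.mem_span_singleton'.1 hz
      exact ⟨Sum.elim x fun _ => c, hadd _⟩
  · refine exact_fromBlocks (f := Fintype.linearCombination (S k n) R.ε)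
      (g := Fintype.linearCombination (S k n) fun _ : Unit => u) R.exact_zero (fun z => ?_)
      fun v => ?_
    · have h : Matrix.vecMul R.ε (ψ 0) = (-u) • K.ε := by
        funext c
        simp [h₀, mul_comm]
      have h' := congrArg (fun w => dotProduct w z) h
      simp only [← Matrix.dotProduct_mulVec] at h'
      simp only [Fintype.linearCombination_apply, smul_eq_mul, Finset.univ_unique,
        Finset.sum_singleton]
      rw [dotProduct_comm] at h'
      refine h'.trans ?_
      rw [smul_dotProduct, smul_eq_mul, neg_mul, mul_comm]
      rfl
    · have hadd : Fintype.linearCombination (S k n) (Sum.elim R.ε fun _ => u) v =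
          Fintype.linearCombination (S k n) R.ε (v ∘ Sum.inl) +
            Fintype.linearCombination (S k n) (fun _ : Unit => u) (v ∘ Sum.inr) := by
        simp [Fintype.linearCombination_apply]
      refine (Eq.congr_left hadd).trans ⟨fun h => ⟨h, ?_⟩, And.left⟩
      -- In a relation among the generators of `I` and `u`, the coefficient of `u` lies in `I : u`,
      -- hence in the image of `K.ε`.
      have hc : v (Sum.inr ()) ∈ I.colon {u} := by
        rw [Submodule.mem_colon_singleton, smul_eq_mul]
        have h' : v (Sum.inr ()) * u =
            -Fintype.linearCombination (S k n) R.ε (v ∘ Sum.inl) := by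
          rw [eq_neg_iff_add_eq_zero, add_comm, ← h]
          simp [Fintype.linearCombination_apply]
        rw [h']
        exact I.neg_mem ((SetLike.ext_iff.1 R.range_ε _).1 ⟨_, rfl⟩)
      obtain ⟨z, hz⟩ := (SetLike.ext_iff.1 K.range_ε _).2 hc
      refine ⟨z, funext fun a => ?_⟩
      simpa [Matrix.mulVec, dotProduct, Fintype.linearCombination_apply, mul_comm] using hz
  · rintro (_ | i)
    · refine exact_fromBlocks_fromBlocks (R.exact_succ 0) (fun v => ?_) (hs 0)
      rw [← K.exact_zero v, funext_iff]
      simp [Matrix.mulVec, dotProduct, Fintype.linearCombination_apply, mul_comm]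
    · exact exact_fromBlocks_fromBlocks (R.exact_succ (i + 1)) (K.exact_succ i) (hs (i + 1))

end LinearResolution

theorem HasLinearResolution.sup_span_singleton {d : ℕ} {I : Ideal (S k n)}
    (hI : HasLinearResolution d I) {u : S k n} (hu : u.IsHomogeneous d)
    (hP : HasLinearResolution 1 (I.colon {u})) : HasLinearResolution d (I ⊔ Ideal.span {u}) :=
  hI.elim fun R => hP.elim fun K => R.nonempty_cone hu K

/-! ### Monomial ideals with linear quotients in one degree -/

theorem hasLinearResolution_bot (d : ℕ) : HasLinearResolution d (⊥ : Ideal (S k n)) :=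
  ⟨{ ι := fun _ => Empty
     fintype := fun _ => inferInstance
     ε := Empty.elim
     φ := fun _ => 0
     ε_homogeneous := fun c => c.elim
     φ_homogeneous := fun _ c => c.elim
     range_ε := by
      rw [LinearMap.range_eq_bot]
      ext c
      exact c.elim
     exact_zero := fun v => ⟨fun _ => ⟨0, Subsingleton.elim _ _⟩, fun _ => by
      simp [Fintype.linearCombination_apply]⟩
     exact_succ := fun _ v => ⟨fun _ => ⟨0, Subsingleton.elim _ _⟩, fun _ =>
      Subsingleton.elim _ _⟩ }⟩

theorem mon_mem_span_iff {A : Set (Fin n →₀ ℕ)} {a : Fin n →₀ ℕ} :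
    mon k a ∈ Ideal.span (mon k '' A) ↔ ∃ b ∈ A, b ≤ a := by
  classical
  rw [mem_ideal_span_monomial_image, support_monomial, if_neg one_ne_zero]
  simp

theorem mul_mon_mem_span_iff {A : Set (Fin n →₀ ℕ)} {u : Fin n →₀ ℕ} {f : S k n} :
    f * mon k u ∈ Ideal.span (mon k '' A) ↔ ∀ c ∈ f.support, ∃ w ∈ A, w ≤ c + u := by
  rw [mem_ideal_span_monomial_image]
  constructor
  · intro h c hc
    exact h (c + u) (by rwa [mem_support_iff, coeff_mul_monomial, mul_one, ← mem_support_iff])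
  · intro h c hc
    rw [mem_support_iff, coeff_mul_monomial'] at hc
    split_ifs at hc with huc
    · obtain ⟨w, hw, hwc⟩ := h (c - u) (by rwa [mul_one, ← mem_support_iff] at hc)
      exact ⟨w, hw, by rwa [tsub_add_cancel_of_le huc] at hwc⟩
    · exact absurd rfl hc

/-- If each colon `w : u` with `w ∈ A` is divisible by a variable of the form `w' : u`, `w' ∈ A`,
then the colon ideal of the monomial ideal `(A)` by `u` is generated by variables. -/
theorem colon_span_mon {A : Set (Fin n →₀ ℕ)} {u : Fin n →₀ ℕ}
    (h : ∀ w ∈ A, ∃ w' ∈ A, ∃ l, w' ≤ u + Finsupp.single l 1 ∧ u l < w l) :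
    (Ideal.span (mon k '' A)).colon {mon k u} =
      Ideal.span (X '' {l | ∃ w ∈ A, w ≤ u + Finsupp.single l 1}) := by
  ext f
  rw [Submodule.mem_colon_singleton, smul_eq_mul, mul_mon_mem_span_iff, mem_ideal_span_X_image]
  refine forall₂_congr fun c hc => ⟨?_, ?_⟩
  · rintro ⟨w, hw, hwc⟩
    obtain ⟨w', hw', l, hl, hlt⟩ := h w hw
    have := hwc l
    rw [Finsupp.add_apply] at this
    exact ⟨l, ⟨w', hw', hl⟩, by omega⟩
  · rintro ⟨l, ⟨w, hw, hwl⟩, hl⟩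
    refine ⟨w, hw, hwl.trans ?_⟩
    rw [add_comm]
    exact add_le_add_left (Finsupp.single_le_iff.2 (by omega)) u

theorem X_image_eq_mon_image (V : Set (Fin n)) :
    (X '' V : Set (S k n)) = mon k '' ((fun i => Finsupp.single i 1) '' V) := by
  rw [Set.image_image]
  rfl

/-- For `a ∉ V` the colon of `(V)` by `x_a` is `(V)` again, so the induction hypothesis supplies
both inputs of the cone. -/
theorem hasLinearResolution_span_X (V : Set (Fin n)) :
    HasLinearResolution 1 (Ideal.span (X '' V) : Ideal (S k n)) := by
  induction V, V.toFinite using Set.Finite.induction_on with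
  | empty => simpa using hasLinearResolution_bot 1
  | @insert a V ha _ ih =>
    rw [Set.image_insert_eq, Ideal.span_insert, sup_comm]
    refine ih.sup_span_singleton (isHomogeneous_X k a) ?_
    rw [X_image_eq_mon_image, show (X a : S k n) = mon k (Finsupp.single a 1) from rfl,
      colon_span_mon]
    · convert ih using 3
      ext l
      constructor
      · rintro ⟨_, ⟨i, hi, rfl⟩, hl⟩
        have h := hl i
        have hia : i ≠ a := fun h => ha (h ▸ hi)
        rw [Finsupp.add_apply, Finsupp.single_eq_same, Finsupp.single_eq_of_ne hia] at h
        by_contra hl'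
        rw [Finsupp.single_eq_of_ne fun h : i = l => hl' (h ▸ hi)] at h
        omega
      · exact fun hl => ⟨_, ⟨l, hl, rfl⟩, le_add_self⟩
    · rintro _ ⟨i, hi, rfl⟩
      refine ⟨_, ⟨i, hi, rfl⟩, i, le_add_self, ?_⟩
      rw [Finsupp.single_eq_of_ne fun h : i = a => ha (h ▸ hi), Finsupp.single_eq_same]
      exact one_pos

/-- Induction removes the `f`-largest generator: its colon is generated by variables, and the
remaining set inherits the condition because each witness `w'` precedes `u`. -/
theorem hasLinearResolution_span_mon {α : Type*} [LinearOrder α] {d : ℕ}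
    (f : (Fin n →₀ ℕ) → α) (hf : Function.Injective f) (A : Finset (Fin n →₀ ℕ))
    (hd : ∀ a ∈ A, a.degree = d)
    (hA : ∀ u ∈ A, ∀ w ∈ A, f w < f u →
      ∃ w' ∈ A, f w' < f u ∧ ∃ l, w' ≤ u + Finsupp.single l 1 ∧ u l < w l) :
    HasLinearResolution d (Ideal.span (mon k '' (A : Set (Fin n →₀ ℕ)))) := by
  induction A using Finset.induction_on_max_value f with
  | empty => simpa using hasLinearResolution_bot d
  | insert u s hus hmax ih =>
    have hlt : ∀ w ∈ s, f w < f u := fun w hw =>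
      (hmax w hw).lt_of_ne fun h => hus (hf h ▸ hw)
    rw [Finset.coe_insert, Set.image_insert_eq, Ideal.span_insert, sup_comm]
    refine (ih (fun a ha => hd a (Finset.mem_insert_of_mem ha)) ?_).sup_span_singleton
      (isHomogeneous_monomial 1 (hd u (Finset.mem_insert_self u s))) ?_
    · intro v hv w hw hwv
      obtain ⟨w', hw', hlt', h⟩ := hA v (Finset.mem_insert_of_mem hv) w
        (Finset.mem_insert_of_mem hw) hwv
      refine ⟨w', Finset.mem_of_mem_insert_of_ne hw' ?_, hlt', h⟩
      rintro rfl
      exact (hlt'.trans (hlt v hv)).false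
    · rw [colon_span_mon]
      · exact hasLinearResolution_span_X _
      · intro w hw
        obtain ⟨w', hw', hlt', h⟩ := hA u (Finset.mem_insert_self u s) w
          (Finset.mem_insert_of_mem hw) (hlt w hw)
        refine ⟨w', Finset.mem_of_mem_insert_of_ne hw' ?_, h⟩
        rintro rfl
        exact hlt'.false

/-! ### Components of an ideal generated by a linear family -/

theorem component_span_mon (A : Set (Fin n →₀ ℕ)) (d : ℕ) :
    component (Ideal.span (mon k '' A)) d =
      Ideal.span (mon k '' {a | a.degree = d ∧ ∃ b ∈ A, b ≤ a}) := by
  apply le_antisymm <;> rw [component, Ideal.span_le]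
  · rintro f ⟨hf, hd⟩
    rw [SetLike.mem_coe, mem_ideal_span_monomial_image]
    rw [mem_ideal_span_monomial_image] at hf
    exact fun c hc => ⟨c, ⟨by
      rw [Finsupp.degree_eq_weight_one]
      exact hd (mem_support_iff.1 hc), hf c hc⟩, le_rfl⟩
  · rintro _ ⟨a, ⟨ha, hb⟩, rfl⟩
    exact Ideal.subset_span ⟨mon_mem_span_iff.2 hb, isHomogeneous_monomial 1 ha⟩

theorem exists_add_single_le {a b : Fin n →₀ ℕ} (h : a ≤ b) (hd : a.degree < b.degree) :
    ∃ p, a + Finsupp.single p 1 ≤ b := by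
  have hne : a ≠ b := by
    rintro rfl
    exact hd.false
  obtain ⟨p, hp⟩ : ∃ p, a p < b p := by
    by_contra! h'
    exact hne (le_antisymm h h')
  refine ⟨p, fun i => ?_⟩
  rw [Finsupp.add_apply]
  by_cases hi : i = p
  · subst hi
    rw [Finsupp.single_eq_same]
    exact hp
  · rw [Finsupp.single_eq_of_ne hi]
    exact h i

/-- A family of exponent vectors of nondecreasing degrees in which each colon `u r : u t`, `r < t`,
is divisible by a variable generating some colon `u q : u t`, `q < t`. -/
structure IsLinearFamily {s : ℕ} (u : Fin s → (Fin n →₀ ℕ)) : Prop where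
  degree_mono : Monotone fun t => (u t).degree
  exists_var : ∀ r t, r < t → ∃ q < t, ∃ l, u q ≤ u t + Finsupp.single l 1 ∧ u t l < u r l

theorem IsLinearFamily.add_left {s : ℕ} {u : Fin s → (Fin n →₀ ℕ)} (hu : IsLinearFamily u)
    (w : Fin n →₀ ℕ) : IsLinearFamily fun t => w + u t where
  degree_mono r t h := by
    simpa only [map_add] using Nat.add_le_add_left (hu.degree_mono h) _
  exists_var r t h := by
    obtain ⟨q, hq, l, h1, h2⟩ := hu.exists_var r t h
    refine ⟨q, hq, l, ?_, ?_⟩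
    · rw [add_assoc]
      exact add_le_add_right h1 w
    · simpa using h2

/-- The least index of a member of the family dividing `a` (and `s` if there is none). -/
noncomputable def leastIndex {s : ℕ} (u : Fin s → (Fin n →₀ ℕ)) (a : Fin n →₀ ℕ) : ℕ :=
  sInf {t | s ≤ t ∨ ∃ h : t < s, u ⟨t, h⟩ ≤ a}

theorem leastIndex_le {s : ℕ} {u : Fin s → (Fin n →₀ ℕ)} {a : Fin n →₀ ℕ} {t : Fin s}
    (h : u t ≤ a) : leastIndex u a ≤ t :=
  Nat.sInf_le (Or.inr ⟨t.2, h⟩)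

theorem exists_leastIndex_eq {s : ℕ} {u : Fin s → (Fin n →₀ ℕ)} {a : Fin n →₀ ℕ}
    (h : ∃ t, u t ≤ a) : ∃ t : Fin s, leastIndex u a = t ∧ u t ≤ a := by
  obtain ⟨t, ht⟩ := h
  have hlt := (leastIndex_le ht).trans_lt t.2
  have hmem : leastIndex u a ∈ {t | s ≤ t ∨ ∃ h : t < s, u ⟨t, h⟩ ≤ a} :=
    Nat.sInf_mem ⟨t, Or.inr ⟨t.2, ht⟩⟩
  obtain h | ⟨_, h⟩ := hmem
  · omega
  · exact ⟨⟨_, hlt⟩, rfl, h⟩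

theorem IsLinearFamily.hasLinearResolution {s : ℕ} {u : Fin s → (Fin n →₀ ℕ)}
    (hu : IsLinearFamily u) (d : ℕ) :
    HasLinearResolution d (component (Ideal.span (mon k '' Set.range u)) d) := by
  have hfin : {a : Fin n →₀ ℕ | a.degree = d ∧ ∃ b ∈ Set.range u, b ≤ a}.Finite :=
    (Finsupp.finite_of_degree_le d).subset fun a ha => ha.1.le
  rw [component_span_mon, ← hfin.coe_toFinset]
  refine hasLinearResolution_span_mon
    -- The dual makes lex-larger monomials come first among those with the same least index.
    (fun a => toLex (leastIndex u a, OrderDual.toDual (toLex a))) ?_ _ ?_ ?_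
  · intro a b hab
    simpa using congrArg (fun x => (ofLex x).2) hab
  · intro a ha
    exact ((hfin.mem_toFinset).1 ha).1
  simp only [Set.Finite.mem_toFinset, Set.mem_ofPred_eq, Set.exists_range_iff, Prod.Lex.toLex_lt_toLex,
    OrderDual.toDual_lt_toDual]
  rintro a ⟨had, ha⟩ w ⟨hwd, hw⟩ hlt
  obtain ⟨t, hat, hta⟩ := exists_leastIndex_eq ha
  obtain ⟨r, hwr, hrw⟩ := exists_leastIndex_eq hw
  rcases hlt with hlt | ⟨heq, hlt⟩
  -- Case of a smaller index: `u q` divides `x_l a`. As `deg (u q) ≤ deg (u t) ≤ d`, some variable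
  -- `x_p` can be removed from `x_l a` while keeping divisibility by `u q`.
  · obtain ⟨q, hqt, l, hql, hl⟩ := hu.exists_var r t (by rw [Fin.lt_def]; omega)
    have hqa : ¬ u q ≤ a := fun h => by
      have := leastIndex_le h
      rw [Fin.lt_def] at hqt
      omega
    have hle : u q ≤ a + Finsupp.single l 1 := hql.trans (add_le_add_left hta _)
    have hdeg : (a + Finsupp.single l 1).degree = d + 1 := by
      rw [map_add, had, Finsupp.degree_single]
    have hmono : ∀ {x y : Fin n →₀ ℕ}, x ≤ y → x.degree ≤ y.degree := fun {x y} h => by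
      obtain ⟨z, rfl⟩ := exists_add_of_le h
      rw [map_add]
      exact Nat.le_add_right _ _
    obtain ⟨p, hp⟩ := exists_add_single_le hle (by
      rw [hdeg, ← had]
      exact Nat.lt_succ_of_le ((hu.degree_mono hqt.le).trans (hmono hta)))
    have hp' := le_add_self.trans hp
    have hqw : u q ≤ a + Finsupp.single l 1 - Finsupp.single p 1 := le_tsub_of_add_le_right hp
    -- Otherwise `u q` would already divide `a`, against the minimality of `t`.
    have hal : a l ≤ u t l := by
      by_contra! h
      refine hqa (hql.trans fun i => ?_)
      rw [Finsupp.add_apply]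
      by_cases hi : i = l
      · subst hi
        rw [Finsupp.single_eq_same]
        exact h
      · rw [Finsupp.single_eq_of_ne hi]
        exact hta i
    refine ⟨a + Finsupp.single l 1 - Finsupp.single p 1, ⟨?_, q, hqw⟩, Or.inl ?_, l, tsub_le_self,
      hal.trans_lt (hl.trans_le (hrw l))⟩
    · have := congrArg Finsupp.degree (tsub_add_cancel_of_le hp')
      rw [map_add, hdeg, Finsupp.degree_single] at this
      omega
    · have := leastIndex_le hqw
      rw [Fin.lt_def] at hqt
      omega
  -- Case of equal indices: `q` is the first place where `a` and `w` differ. Equal degrees force a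
  -- later `p` with `w p < a p`, and the witness is `x_q a / x_p`. It stays divisible by `u r`
  -- because `u r p ≤ w p < a p`.
  · obtain ⟨q, hq, hqlt⟩ := Finsupp.Lex.lt_iff.1 hlt
    simp only [ofLex_toLex] at hq hqlt
    obtain ⟨p, hp⟩ : ∃ p, w p < a p := by
      by_contra! h
      have := Finset.sum_lt_sum (fun i _ => h i) ⟨q, Finset.mem_univ q, hqlt⟩
      rw [← Finsupp.degree_eq_sum, ← Finsupp.degree_eq_sum] at this
      omega
    have hqp : q < p := by
      rcases lt_trichotomy p q with h | rfl | h
      · exact absurd (hq p h) hp.ne'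
      · exact absurd hp hqlt.not_gt
      · exact h
    have hrt : r = t := Fin.ext (by omega)
    subst hrt
    have hval : ∀ i, (a + Finsupp.single q 1 - Finsupp.single p 1 : Fin n →₀ ℕ) i =
        if i = p then a i - 1 else if i = q then a i + 1 else a i := by
      intro i
      rw [Finsupp.tsub_apply, Finsupp.add_apply]
      by_cases h1 : i = p
      · subst h1
        rw [if_pos rfl, Finsupp.single_eq_same, Finsupp.single_eq_of_ne hqp.ne', add_zero]
      · rw [if_neg h1, Finsupp.single_eq_of_ne h1]
        by_cases h2 : i = q
        · subst h2
          rw [if_pos rfl, Finsupp.single_eq_same, tsub_zero]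
        · rw [if_neg h2, Finsupp.single_eq_of_ne h2, add_zero, tsub_zero]
    have hrw' : u r ≤ a + Finsupp.single q 1 - Finsupp.single p 1 := by
      intro i
      rw [hval]
      have := hta i
      split_ifs with h1 h2
      · subst h1
        have := hrw i
        omega
      · omega
      · exact this
    have hlex : toLex a < toLex (a + Finsupp.single q 1 - Finsupp.single p 1) := by
      refine Finsupp.Lex.lt_iff.2 ⟨q, fun i hi => ?_, ?_⟩
      · simp only [ofLex_toLex]
        rw [hval, if_neg (hi.trans hqp).ne, if_neg hi.ne]
      · simp only [ofLex_toLex]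
        rw [hval, if_neg hqp.ne, if_pos rfl]
        exact Nat.lt_succ_self _
    refine ⟨_, ⟨?_, r, hrw'⟩, ?_, q, tsub_le_self, hqlt⟩
    · have hp' : Finsupp.single p 1 ≤ a + Finsupp.single q 1 :=
        (Finsupp.single_le_iff.2 (by omega)).trans le_self_add
      have := congrArg Finsupp.degree (tsub_add_cancel_of_le hp')
      rw [map_add, map_add, Finsupp.degree_single, Finsupp.degree_single] at this
      omega
    · have := leastIndex_le hrw'
      rw [← hat] at this
      exact this.lt_or_eq.imp id fun h => ⟨h, hlex⟩

/-! ### Critical ideals -/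

/-- `I` is minimally generated by a linear family of monomials. -/
def HasLinearFamily (I : Ideal (S k n)) : Prop :=
  ∃ (s : ℕ) (u : Fin s → (Fin n →₀ ℕ)), IsLinearFamily u ∧ (∀ r t, u r ≤ u t → r = t) ∧
    I = Ideal.span (mon k '' Set.range u)

theorem minGens_span_mon_range {s : ℕ} {u : Fin s → (Fin n →₀ ℕ)}
    (hu : ∀ r t, u r ≤ u t → r = t) :
    minGens (Ideal.span (mon k '' Set.range u)) = Set.range u := by
  ext a
  simp only [minGens, Set.mem_ofPred_eq, Minimal, mon_mem_span_iff, Set.exists_range_iff]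
  constructor
  · rintro ⟨⟨t, ht⟩, h⟩
    exact ⟨t, le_antisymm ht (h ⟨t, le_rfl⟩ ht)⟩
  · rintro ⟨t, rfl⟩
    refine ⟨⟨t, le_rfl⟩, fun b ⟨r, hr⟩ hb => ?_⟩
    rwa [hu r t (hr.trans hb)] at hr

theorem span_mon_mul_span (w : Fin n →₀ ℕ) {s : ℕ} (u : Fin s → (Fin n →₀ ℕ)) :
    Ideal.span {mon k w} * Ideal.span (mon k '' Set.range u) =
      Ideal.span (mon k '' Set.range fun t => w + u t) := by
  rw [Ideal.span_mul_span', Set.singleton_mul, Set.image_image, ← Set.range_comp, ← Set.range_comp]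
  congr 2
  funext t
  simp [monomial_mul]

theorem hasLinearFamily_top : HasLinearFamily (⊤ : Ideal (S k n)) := by
  refine ⟨1, fun _ => 0, ⟨fun _ _ _ => le_rfl, fun r t h => absurd h (by omega)⟩,
    fun r t _ => Subsingleton.elim r t, ?_⟩
  rw [eq_comm, Ideal.eq_top_iff_one]
  exact mon_mem_span_iff.2 ⟨0, ⟨0, rfl⟩, le_rfl⟩

theorem HasLinearFamily.mon_mul {I : Ideal (S k n)} (hI : HasLinearFamily I) (w : Fin n →₀ ℕ) :
    HasLinearFamily (Ideal.span {mon k w} * I) := by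
  obtain ⟨s, u, hu, hanti, rfl⟩ := hI
  exact ⟨s, _, hu.add_left w, fun r t h => hanti r t (le_of_add_le_add_left h),
    span_mon_mul_span w u⟩

theorem HasLinearFamily.X_add {I : Ideal (S k n)} (hI : HasLinearFamily I) {j : Fin n}
    (hj : ∀ m ∈ minGens I, m j = 0) : HasLinearFamily (Ideal.span {X j} + I) := by
  obtain ⟨s, u, hu, hanti, rfl⟩ := hI
  rw [minGens_span_mon_range hanti, Set.forall_mem_range] at hj
  -- If `1` is a generator the sum is the unit ideal and `x_j` is not minimal; otherwise all later
  -- degrees are at least `1`, the degree of `x_j`.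
  by_cases h0 : ∃ t, u t = 0
  · obtain ⟨t, ht⟩ := h0
    convert hasLinearFamily_top
    rw [Ideal.eq_top_iff_one]
    exact Ideal.mem_sup_right (mon_mem_span_iff.2 ⟨0, ⟨t, ht⟩, le_rfl⟩)
  push Not at h0
  refine ⟨s + 1, Fin.cons (Finsupp.single j 1) u, ⟨?_, ?_⟩, ?_, ?_⟩
  · intro r t
    refine Fin.cases ?_ (fun t => ?_) t <;> refine Fin.cases ?_ (fun r => ?_) r <;> intro h
    · exact le_rfl
    · exact absurd h (by simp)
    · simp only [Fin.cons_zero, Fin.cons_succ, Finsupp.degree_single]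
      rw [Nat.one_le_iff_ne_zero, ne_eq, Finsupp.degree_eq_zero_iff]
      exact h0 t
    · simpa using hu.degree_mono (Fin.succ_le_succ_iff.1 h)
  · intro r t
    refine Fin.cases ?_ (fun t => ?_) t <;> refine Fin.cases ?_ (fun r => ?_) r <;> intro h
    · exact absurd h (by simp)
    · exact absurd h (by simp)
    · refine ⟨0, h, j, ?_, ?_⟩
      · simp
      · simp [hj t]
    · obtain ⟨q, hq, l, h1, h2⟩ := hu.exists_var r t (Fin.succ_lt_succ_iff.1 h)
      exact ⟨q.succ, Fin.succ_lt_succ_iff.2 hq, l, by simpa using h1, by simpa using h2⟩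
  · intro r t
    refine Fin.cases ?_ (fun t => ?_) t <;> refine Fin.cases ?_ (fun r => ?_) r <;> intro h
    · rfl
    · refine absurd (Finsupp.ext fun i => ?_) (h0 r)
      simp only [Fin.cons_zero, Fin.cons_succ] at h
      by_cases hi : i = j
      · subst hi
        exact hj r
      · have := h i
        rw [Finsupp.single_eq_of_ne hi] at this
        simpa using this
    · have := h j
      simp [hj t] at this
    · rw [hanti r t (by simpa using h)]
  · rw [Fin.range_cons, Set.image_insert_eq, Ideal.span_insert]
    rfl

theorem IsCritical.hasLinearFamily {I : Ideal (S k n)} (hI : IsCritical I) :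
    HasLinearFamily I := by
  have key : ∀ {J : Ideal (S k n)} {j : Fin n} {m' : Fin n →₀ ℕ}, HasLinearFamily J →
      (∀ m ∈ minGens J, (m + m') j = 0) →
      HasLinearFamily (Ideal.span {X j} + Ideal.span {mon k m'} * J) := by
    intro J j m' hJ hj
    refine (hJ.mon_mul m').X_add fun m hm => ?_
    obtain ⟨s, u, hu, hanti, rfl⟩ := hJ
    rw [span_mon_mul_span, minGens_span_mon_range fun r t h =>
      hanti r t (le_of_add_le_add_left h)] at hm
    rw [minGens_span_mon_range hanti] at hj
    obtain ⟨t, rfl⟩ := hm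
    simpa only [add_comm] using hj _ ⟨t, rfl⟩
  induction hI with
  -- Here `(x_i, m)` is `(x_i) + m J` with `J` the unit ideal, whose only minimal generator is `1`.
  | base i m _ him =>
    have h := key (j := i) (m' := m) (hasLinearFamily_top (k := k)) fun a ha => by
      have h0 : a = 0 := le_antisymm (ha.2 (y := 0) Submodule.mem_top zero_le) zero_le
      rw [h0, zero_add, him]
    rwa [Ideal.mul_top, Ideal.add_eq_sup, ← Ideal.span_insert] at h
  | step j m' J _ _ hj _ ih => exact key ih hj

theorem HasLinearFamily.hasLinearQuotients {I : Ideal (S k n)} (hI : HasLinearFamily I) :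
    HasLinearQuotients I := by
  obtain ⟨s, u, hu, hanti, rfl⟩ := hI
  refine ⟨⟨_, rfl⟩, s, u, fun r t h => hanti r t h.le, (minGens_span_mon_range hanti).symm,
    fun t => ?_⟩
  rw [← Set.image_image (mon k) u]
  refine ⟨_, colon_span_mon ?_⟩
  rintro _ ⟨r, hr, rfl⟩
  obtain ⟨q, hq, h⟩ := hu.exists_var r t hr
  exact ⟨u q, ⟨q, hq, rfl⟩, h⟩

theorem HasLinearFamily.isComponentwiseLinear {I : Ideal (S k n)} (hI : HasLinearFamily I) :
    IsComponentwiseLinear I := by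
  obtain ⟨s, u, hu, -, rfl⟩ := hI
  refine ⟨Ideal.homogeneous_span _ _ ?_, fun d => hu.hasLinearResolution d⟩
  rintro _ ⟨a, -, rfl⟩
  exact ⟨a.degree, isHomogeneous_monomial 1 rfl⟩

end CriticalIdeal

theorem mainTheorem5 {k : Type*} [Field k] {n : ℕ} :
    (∀ I : Ideal (CriticalIdeal.S k n),
      CriticalIdeal.IsCritical I → CriticalIdeal.HasLinearQuotients I) ∧
    (∀ I : Ideal (CriticalIdeal.S k n),
      CriticalIdeal.IsCanonicalCritical I → CriticalIdeal.IsComponentwiseLinear I) := by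
  refine ⟨fun I hI => hI.hasLinearFamily.hasLinearQuotients, ?_⟩
  rintro I ⟨-, w, J, hJ, rfl⟩
  exact (hJ.hasLinearFamily.mon_mul w).isComponentwiseLinear
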